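/- For $n\ge 0$ let $\pi=\pi_1\pi_2\cdots\pi_n\in\mathfrak S_n$ be a permutation, and let $R(\pi)$ be the set of its reduced words, i.e. the words $i_1i_2\cdots i_k$ of minimal length with $\pi=s_{i_1}s_{i_2}\cdots s_{i_k}$, where $s_i$ is the adjacent transposition $(i\;\,i+1)$, $1\le i\le n-1$. Let $G_\pi$ be the graph on $R(\pi)$ in which two reduced words are adjacent when one is obtained from the other by a commutation move (exchanging adjacent letters $j,k$ with $|j-k|>1$) or by a long braid move (exchanging consecutive letters $j(j+1)j$ and $(j+1)j(j+1)$). Let $H_{ij}=\{x\in\mathbb R^n: x_i=x_j\}$, $1\le i<j\le n$, be the hyperplanes of the braid arrangement and let $c_0=\{x: x_1<x_2<\cdots<x_n\}$. Let $L_1(\pi)$ be the set of the hyperplanes $H_{ij}$ that separate $c_0$ from $\pi(c_0)$, where $\pi$ acts on $\mathbb R^n$ by $e_i\mapsto e_{\pi_i}$, and let $L_2(\pi)$ be the set of the intersections $X=H\cap K$ of two distinct hyperplanes of the arrangement such that every hyperplane of the arrangement containing $X$ belongs to $L_1(\pi)$. An inversion of $\pi$ is a pair $(i,j)$ with $i<j$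 and $\pi_i>\pi_j$. Let $I_2(\pi)$ be the set of unordered pairs of inversions $(i,j)$, $(k,\ell)$ of $\pi$ with $\{i,j\}\cap\{k,\ell\}=\emptyset$, and let $I_3(\pi)$ be the set of triples $i<j<k$ with $\pi_i>\pi_j>\pi_k$ (the occurrences of the pattern $321$). **Theorem.** If $\pi$ avoids the pattern $312$, i.e. there are no $i<j<k$ with $\pi_j<\pi_k<\pi_i$, then $G_\pi$ is connected and $$\operatorname{diam}(G_\pi)=|L_2(\pi)|=|I_2(\pi)|+|I_3(\pi)| .$$ -/

import Mathlib

namespace RedWord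

/-! ### Patterns, inversions -/

/-- `π` contains the pattern `σ`: some subsequence of the one-line notation of `π`
is order isomorphic to the one-line notation of `σ`. -/
def Contains {n k : ℕ} (π : Equiv.Perm (Fin n)) (σ : Equiv.Perm (Fin k)) : Prop :=
  ∃ f : Fin k ↪o Fin n, ∀ a b : Fin k, σ a ≤ σ b ↔ π (f a) ≤ π (f b)

/-- `π` avoids the pattern `σ`. -/
def Avoids {n k : ℕ} (π : Equiv.Perm (Fin n)) (σ : Equiv.Perm (Fin k)) : Prop :=
  ¬ Contains π σ

/-- The permutation with one-line notation `312` (written `2, 0, 1` on `Fin 3`). -/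
def perm312 : Equiv.Perm (Fin 3) where
  toFun := ![2, 0, 1]
  invFun := ![1, 2, 0]
  left_inv := by decide
  right_inv := by decide

/-- `(i, j)` is an inversion of `π`: `i < j` and `π i > π j`. -/
abbrev IsInversion {n : ℕ} (π : Equiv.Perm (Fin n)) (i j : Fin n) : Prop :=
  i < j ∧ π j < π i

/-- `I₂(π)`: the (unordered) pairs of inversions `(i, j)`, `(k, l)` of `π` whose index sets
`{i, j}` and `{k, l}` are disjoint. Each unordered pair is recorded once, with `i < k`. -/
def I2 {n : ℕ} (π : Equiv.Perm (Fin n)) : Finset ((Fin n × Fin n) × (Fin n × Fin n)) :=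
  {p | IsInversion π p.1.1 p.1.2 ∧ IsInversion π p.2.1 p.2.2 ∧
    Disjoint ({p.1.1, p.1.2} : Finset (Fin n)) {p.2.1, p.2.2} ∧ p.1.1 < p.2.1}

/-- `I₃(π)`: the triples `(i, j, k)` such that `(i, j)`, `(i, k)`, `(j, k)` are all inversions
of `π`, that is, the occurrences of the pattern `321`. -/
def I3 {n : ℕ} (π : Equiv.Perm (Fin n)) : Finset (Fin n × Fin n × Fin n) :=
  {t | IsInversion π t.1 t.2.1 ∧ IsInversion π t.1 t.2.2 ∧ IsInversion π t.2.1 t.2.2}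

/-! ### Reduced words and their graph -/

/-- The simple reflection exchanging the two consecutive elements `i`, `i + 1` of `Fin n`. -/
def simpleRefl {n : ℕ} (i : Fin (n - 1)) : Equiv.Perm (Fin n) :=
  Equiv.swap ⟨i.1, by omega⟩ ⟨i.1 + 1, by omega⟩

/-- The product `s_{i₁} s_{i₂} ⋯ s_{iₖ}` for a word `i₁ i₂ ⋯ iₖ`. -/
def wordProd {n : ℕ} (w : List (Fin (n - 1))) : Equiv.Perm (Fin n) :=
  (w.map simpleRefl).prod

/-- `w` is a reduced word for `π`: its product is `π` and it has minimal length. -/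
def IsReducedWord {n : ℕ} (π : Equiv.Perm (Fin n)) (w : List (Fin (n - 1))) : Prop :=
  wordProd w = π ∧ ∀ w' : List (Fin (n - 1)), wordProd w' = π → w.length ≤ w'.length

/-- `R(π)`, the reduced words for `π`. -/
abbrev R {n : ℕ} (π : Equiv.Perm (Fin n)) : Type :=
  {w : List (Fin (n - 1)) // IsReducedWord π w}

/-- Commutation move: exchange adjacent letters `j`, `k` with `|j - k| > 1`. -/
inductive CommMove {m : ℕ} : List (Fin m) → List (Fin m) → Prop
  | mk (u v : List (Fin m)) (j k : Fin m) (h : j.1 + 1 < k.1 ∨ k.1 + 1 < j.1) :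
      CommMove (u ++ [j, k] ++ v) (u ++ [k, j] ++ v)

/-- Long braid move: exchange consecutive letters `j k j` for `k j k`, where `|j - k| = 1`. -/
inductive BraidMove {m : ℕ} : List (Fin m) → List (Fin m) → Prop
  | mk (u v : List (Fin m)) (j k : Fin m) (h : j.1 + 1 = k.1 ∨ k.1 + 1 = j.1) :
      BraidMove (u ++ [j, k, j] ++ v) (u ++ [k, j, k] ++ v)

theorem CommMove.symm {m : ℕ} {w w' : List (Fin m)} (h : CommMove w w') : CommMove w' w := by
  cases h with
  | mk u v j k h => exact CommMove.mk u v k j h.symm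

theorem BraidMove.symm {m : ℕ} {w w' : List (Fin m)} (h : BraidMove w w') : BraidMove w' w := by
  cases h with
  | mk u v j k h => exact BraidMove.mk u v k j h.symm

theorem CommMove.ne {m : ℕ} {w w' : List (Fin m)} (h : CommMove w w') : w ≠ w' := by
  cases h with
  | mk u v j k h =>
    intro e
    simp at e
    rcases e with ⟨rfl, -⟩
    omega

theorem BraidMove.ne {m : ℕ} {w w' : List (Fin m)} (h : BraidMove w w') : w ≠ w' := by
  cases h with
  | mk u v j k h =>
    intro e
    simp at e
    rcases e with ⟨rfl, -⟩
    omega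

/-- The graph `G_π` on `R(π)`, with an edge for each commutation move and each long braid move. -/
def G {n : ℕ} (π : Equiv.Perm (Fin n)) : SimpleGraph (R π) where
  Adj w w' := CommMove w.1 w'.1 ∨ BraidMove w.1 w'.1
  symm := ⟨fun _ _ h => h.imp CommMove.symm BraidMove.symm⟩
  loopless := ⟨fun _ h => h.elim (fun h => h.ne rfl) (fun h => h.ne rfl)⟩

/-! ### The braid arrangement -/

/-- The hyperplane `H_{ij} = {x | x i = x j}` of `ℝⁿ`. -/
def hyper {n : ℕ} (i j : Fin n) : Submodule ℝ (Fin n → ℝ) where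
  carrier := {x | x i = x j}
  add_mem' := by
    intro x y hx hy
    simp only [Set.mem_ofPred_eq, Pi.add_apply] at *
    rw [hx, hy]
  zero_mem' := rfl
  smul_mem' := by
    intro c x hx
    simp only [Set.mem_ofPred_eq, Pi.smul_apply] at *
    rw [hx]

/-- The reflection arrangement of type `A_{n-1}`: all `H_{ij}` with `i < j`. -/
def arrangement (n : ℕ) : Set (Submodule ℝ (Fin n → ℝ)) :=
  {H | ∃ i j : Fin n, i < j ∧ H = hyper i j}

/-- The base chamber `c₀ = {x | x₁ < x₂ < ⋯ < xₙ}`. -/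
def baseChamber (n : ℕ) : Set (Fin n → ℝ) :=
  {x | StrictMono x}

/-- The chamber `π(c₀)`, where `π` permutes coordinates by `e_i ↦ e_{π i}`. -/
def permChamber {n : ℕ} (π : Equiv.Perm (Fin n)) : Set (Fin n → ℝ) :=
  (fun x i => x (π.symm i)) '' baseChamber n

/-- The hyperplane `H` separates `c` from `c'`: they lie strictly on opposite sides of `H`. -/
def Separates {n : ℕ} (H : Submodule ℝ (Fin n → ℝ)) (c c' : Set (Fin n → ℝ)) : Prop :=
  ∃ f : (Fin n → ℝ) →ₗ[ℝ] ℝ, LinearMap.ker f = H ∧ (∀ x ∈ c, 0 < f x) ∧ ∀ y ∈ c', f y < 0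

/-- `L₁(π)`: the hyperplanes of the arrangement separating `c₀` from `π(c₀)`. -/
def L1 {n : ℕ} (π : Equiv.Perm (Fin n)) : Set (Submodule ℝ (Fin n → ℝ)) :=
  {H | H ∈ arrangement n ∧ Separates H (baseChamber n) (permChamber π)}

/-- `L₂(π)`: the codimension-two intersections `X = H ∩ K` of two distinct hyperplanes of the
arrangement such that every hyperplane of the arrangement containing `X` belongs to `L₁(π)`. -/
def L2 {n : ℕ} (π : Equiv.Perm (Fin n)) : Set (Submodule ℝ (Fin n → ℝ)) :=
  {X | (∃ H ∈ arrangement n, ∃ K ∈ arrangement n, H ≠ K ∧ X = H ⊓ K) ∧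
    ∀ H ∈ arrangement n, X ≤ H → H ∈ L1 π}

end RedWord

namespace RedWord

/-! ### Moves between words in the natural numbers -/

/-! Read a word from left to right as a sequence of exchanges of adjacent positions, starting at the
identity. In a reduced word the strand of the smallest value only moves right, from position 0 to
its final position `k`. Deleting it leaves a reduced word of the remaining permutation. Iterating
this encodes the permutation by the list of positions `k` (its code), and a word is reduced exactly
when the strand is monotone at each stage (`IsCode.isReducedWord_iff`).

All crossings of the smallest strand can be pushed to the end of the word (`reach_postpone`). If the
permutation avoids 312, the other values split into two blocks at position `k`: those before it are
smaller than those after it. Hence no remaining crossing straddles that position, and the crossings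
can also be pulled to the front (`reach_advance`). A crossing of two other strands costs `k - 1` in
total for both operations if it lies before position `k`, and `k` if it lies after, whatever the
word (`postponeCost_add_advanceCost`).

Recursively, the postponing costs add up to a potential on reduced words. With D = `codeDiam`, a
word `w` of potential P(w) is within P(w) moves of `lastWord` and within D - P(w) moves of
`firstWord`. Two words are joined through one of these, with P(w) + P(w') or 2D - P(w) - P(w')
moves, and one of these numbers is at most D. Conversely, a move either acts on the word with the
strand deleted, leaving the postponing cost alone, or fixes that word and alters the cost by at most
one (`Step.proj`). So the potential is 1-Lipschitz, and as it is 0 at `lastWord` and D at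
`firstWord`, the diameter is D.

The same recursion, deleting the smallest value, computes |I₂| + |I₃| (`card_I2_add_card_I3`).
Independently of pattern avoidance, the elements of L₂ correspond bijectively to I₂ and I₃ together
(`encard_L2`): rank-two flats of the braid arrangement merge either two disjoint pairs of
coordinates or one triple. -/

/-- A commutation move or a long braid move. -/
inductive Step : List ℕ → List ℕ → Prop
  | comm (j k : ℕ) (v : List ℕ) (h : j + 1 < k ∨ k + 1 < j) : Step (j :: k :: v) (k :: j :: v)
  | braid (j k : ℕ) (v : List ℕ) (h : j + 1 = k ∨ k + 1 = j) :
      Step (j :: k :: j :: v) (k :: j :: k :: v)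
  | cons (i : ℕ) {w w' : List ℕ} (h : Step w w') : Step (i :: w) (i :: w')

theorem Step.symm {w w' : List ℕ} (h : Step w w') : Step w' w := by
  induction h with
  | comm j k v h => exact .comm k j v h.symm
  | braid j k v h => exact .braid k j v h.symm
  | cons i _ ih => exact .cons i ih

theorem Step.append_left (u : List ℕ) {w w' : List ℕ} (h : Step w w') :
    Step (u ++ w) (u ++ w') := by
  induction u with
  | nil => exact h
  | cons i u ih => exact .cons i ih

theorem Step.append_right (v : List ℕ) {w w' : List ℕ} (h : Step w w') :
    Step (w ++ v) (w' ++ v) := by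
  induction h with
  | comm j k v h => exact .comm j k _ h
  | braid j k v h => exact .braid j k _ h
  | cons i _ ih => exact .cons i ih

theorem Step.mem_iff {w w' : List ℕ} (h : Step w w') (i : ℕ) : i ∈ w' ↔ i ∈ w := by
  induction h with
  | comm j k v h => simp only [List.mem_cons]; tauto
  | braid j k v h => simp only [List.mem_cons]; tauto
  | cons i _ ih => simp only [List.mem_cons, ih]

/-- `Reach d w w'`: the word `w'` is obtained from `w` by a sequence of `d` moves. -/
inductive Reach : ℕ → List ℕ → List ℕ → Prop
  | refl (w : List ℕ) : Reach 0 w w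
  | head {d : ℕ} {w w' w'' : List ℕ} (h : Step w w') (h' : Reach d w' w'') : Reach (d + 1) w w''

theorem Reach.of_eq {w w' : List ℕ} (h : w = w') : Reach 0 w w' := h ▸ .refl w

theorem Step.reach {w w' : List ℕ} (h : Step w w') : Reach 1 w w' := .head h (.refl _)

theorem Reach.trans {d e : ℕ} {w w' w'' : List ℕ} (h : Reach d w w') (h' : Reach e w' w'') :
    Reach (d + e) w w'' := by
  induction h with
  | refl w => simpa using h'
  | head h _ ih => rw [Nat.add_right_comm]; exact .head h (ih h')

theorem Reach.symm {d : ℕ} {w w' : List ℕ} (h : Reach d w w') : Reach d w' w := by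
  induction h with
  | refl w => exact .refl w
  | head h _ ih => exact ih.trans h.symm.reach

theorem Reach.append_left (u : List ℕ) {d : ℕ} {w w' : List ℕ} (h : Reach d w w') :
    Reach d (u ++ w) (u ++ w') := by
  induction h with
  | refl w => exact .refl _
  | head h _ ih => exact .head (h.append_left u) ih

theorem Reach.append_right (v : List ℕ) {d : ℕ} {w w' : List ℕ} (h : Reach d w w') :
    Reach d (w ++ v) (w' ++ v) := by
  induction h with
  | refl w => exact .refl _
  | head h _ ih => exact .head (h.append_right v) ih

theorem Reach.cons (i : ℕ) {d : ℕ} {w w' : List ℕ} (h : Reach d w w') :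
    Reach d (i :: w) (i :: w') := h.append_left [i]

/-- The renaming of letters when a new strand is inserted in position `k`. -/
def lift (k j : ℕ) : ℕ := if j + 1 < k then j else j + 1

theorem Step.map_lift {k : ℕ} {w w' : List ℕ} (h : Step w w') (hk : ∀ j ∈ w, j + 1 ≠ k) :
    Step (w.map (lift k)) (w'.map (lift k)) := by
  induction h with
  | comm a b v h =>
    have ha := hk a (by simp)
    have hb := hk b (by simp)
    refine .comm _ _ _ ?_
    unfold lift
    split_ifs <;> omega
  | braid a b v h =>
    have ha := hk a (by simp)
    have hb := hk b (by simp)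
    refine .braid _ _ _ ?_
    unfold lift
    split_ifs <;> omega
  | cons i h ih => exact .cons _ (ih fun j hj => hk j (by simp [hj]))

theorem Reach.map_lift {k d : ℕ} {w w' : List ℕ} (h : Reach d w w') (hk : ∀ j ∈ w, j + 1 ≠ k) :
    Reach d (w.map (lift k)) (w'.map (lift k)) := by
  induction h with
  | refl w => exact .refl _
  | head h _ ih => exact .head (h.map_lift hk) (ih fun j hj => hk j ((h.mem_iff j).1 hj))

theorem reach_commute_past (i : ℕ) (l v : List ℕ) (h : ∀ x ∈ l, i + 1 < x ∨ x + 1 < i) :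
    Reach l.length (i :: (l ++ v)) (l ++ i :: v) := by
  induction l with
  | nil => exact .refl _
  | cons x l ih =>
    exact .head (.comm i x _ (h x (by simp))) ((ih fun y hy => h y (by simp [hy])).cons x)

theorem reach_range_commute {i p m : ℕ} (v : List ℕ) (h : i + 1 < p ∨ p + m < i) :
    Reach m (i :: (List.range' p m ++ v)) (List.range' p m ++ i :: v) := by
  have := reach_commute_past i (List.range' p m) v (by
    intro x hx
    rw [List.mem_range'_1] at hx
    omega)
  simpa using this

/-- The letter meets `i, i + 1` in one braid move, which lowers it by one, and commutes with the
other `m - 2` letters of the run. -/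
theorem reach_range_braid {i p m : ℕ} (v : List ℕ) (h : p ≤ i) (h' : i + 1 < p + m) :
    Reach (m - 1) ((i + 1) :: (List.range' p m ++ v)) (List.range' p m ++ i :: v) := by
  obtain ⟨a, rfl⟩ := Nat.exists_eq_add_of_le h
  obtain ⟨b, rfl⟩ : ∃ b, m = a + (2 + b) := ⟨m - a - 2, by omega⟩
  have e : List.range' p (a + (2 + b)) =
      List.range' p a ++ (p + a) :: (p + a + 1) :: List.range' (p + a + 2) b := by
    rw [← List.range'_append_1, ← List.range'_append_1 (s := p + a)]
    simp [List.range'_succ]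
  rw [e]
  have h1 := reach_commute_past (p + a + 1) (List.range' p a)
    ((p + a) :: (p + a + 1) :: (List.range' (p + a + 2) b ++ v)) (by
    intro x hx
    rw [List.mem_range'_1] at hx
    omega)
  have h2 : Step ((p + a + 1) :: (p + a) :: (p + a + 1) :: (List.range' (p + a + 2) b ++ v))
    ((p + a) :: (p + a + 1) :: (p + a) :: (List.range' (p + a + 2) b ++ v)) :=
    .braid _ _ _ (by omega)
  have h3 := reach_commute_past (p + a) (List.range' (p + a + 2) b) v (by
    intro x hx
    rw [List.mem_range'_1] at hx
    omega)
  have := (h1.trans (h2.append_left (List.range' p a)).reach).trans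
    (((h3.cons (p + a + 1)).cons (p + a)).append_left (List.range' p a))
  simp only [List.length_range'] at this
  have e2 : a + (2 + b) - 1 = a + 1 + b := by omega
  rw [e2]
  simpa using this

/-! ### Deleting the smallest value from a gallery -/

/-- The final position of a strand starting in position `p`. -/
def pos : ℕ → List ℕ → ℕ
  | p, [] => p
  | p, i :: w => if i = p then pos (p + 1) w else if i + 1 = p then pos i w else pos p w

/-- The word of the remaining strands when the one starting in position `p` is deleted. -/
def proj : ℕ → List ℕ → List ℕ
  | _, [] => []
  | p, i :: w => if i = p then proj (p + 1) w else if i + 1 = p then proj i w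
      else (if i < p then i else i - 1) :: proj p w

/-- The strand starting in position `p` never moves to the left. -/
def Mono : ℕ → List ℕ → Prop
  | _, [] => True
  | p, i :: w => if i = p then Mono (p + 1) w else i + 1 ≠ p ∧ Mono p w

/-- The number of moves that postpone all the crossings of the strand starting in position `p`. -/
def postponeCost : ℕ → List ℕ → ℕ
  | _, [] => 0
  | p, i :: w => if i = p then postponeCost (p + 1) w
      else (if i < p then p - 1 else p) + postponeCost p w

/-- The number of moves that advance all the crossings of the strand going from position `p`
to position `k`. -/
def advanceCost (k : ℕ) : ℕ → List ℕ → ℕ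
  | _, [] => 0
  | p, i :: w => if i = p then advanceCost k (p + 1) w
      else (if i < p ∨ k < i then k - p else k - p - 1) + advanceCost k p w

theorem le_pos {p : ℕ} {w : List ℕ} (h : Mono p w) : p ≤ pos p w := by
  induction w generalizing p with
  | nil => exact le_rfl
  | cons i w ih =>
    simp only [Mono, pos] at *
    split_ifs at * with h1 h2
    · exact (Nat.le_succ p).trans (ih h)
    · exact absurd h2 h.1
    · exact ih h.2

/-- The run `0, …, p - 1` in front stands for the crossings already met and held back. Each letter
not involving the strand is moved left across that run; each letter involving it lengthens the run.
-/
theorem reach_postpone {p : ℕ} {w : List ℕ} (h : Mono p w) :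
    Reach (postponeCost p w) (List.range' 0 p ++ w)
      ((proj p w).map (· + 1) ++ List.range' 0 (pos p w)) := by
  induction w generalizing p with
  | nil => simpa [postponeCost, proj, pos] using Reach.refl _
  | cons i w ih =>
    simp only [Mono, pos, proj, postponeCost] at h ⊢
    by_cases h1 : i = p
    · subst h1
      simp only [if_true] at h ⊢
      have := ih h
      rwa [← List.range'_append_1, Nat.zero_add, List.append_assoc] at this
    · simp only [h1, if_false] at h ⊢
      obtain ⟨h2, h3⟩ := h
      simp only [h2, if_false]
      have := ih h3
      by_cases h4 : i < p
      · simp only [h4, if_true]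
        exact (reach_range_braid (i := i) (p := 0) (m := p) w (by omega) (by omega)).symm.trans
          (this.cons (i + 1))
      · simp only [h4, if_false]
        obtain ⟨j, rfl⟩ : ∃ j, i = j + 1 := ⟨i - 1, by omega⟩
        exact (reach_range_commute (i := j + 1) (p := 0) (m := p) w (by omega)).symm.trans
          (this.cons (j + 1))

/-- Here letters are moved right across the run that carries the strand from `p` to its final
position. The hypothesis excludes a crossing of the two strands on either side of that position,
which could not be performed once the strand stands between them. -/
theorem reach_advance {p : ℕ} {w : List ℕ} (h : Mono p w) (hk : ∀ j ∈ proj p w, j + 1 ≠ pos p w) :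
    Reach (advanceCost (pos p w) p w) w
      (List.range' p (pos p w - p) ++ (proj p w).map (lift (pos p w))) := by
  induction w generalizing p with
  | nil => simpa [advanceCost, proj, pos] using Reach.refl _
  | cons i w ih =>
    have hp := le_pos h
    simp only [Mono, pos, proj, advanceCost] at *
    by_cases h1 : i = p
    · subst h1
      simp only [if_true] at h hk hp ⊢
      have hp' := le_pos h
      have := (ih h hk).cons i
      have e : pos (i + 1) w - i = (pos (i + 1) w - (i + 1)) + 1 := by omega
      rwa [e, List.range'_succ]
    · simp only [h1, if_false] at h hk hp ⊢
      obtain ⟨h2, h3⟩ := h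
      simp only [h2, if_false] at hk hp ⊢
      have hk1 := hk _ (List.mem_cons_self ..)
      have := (ih h3 fun j hj => hk j (List.mem_cons_of_mem _ hj)).cons i
      rw [Nat.add_comm]
      refine this.trans ?_
      rw [List.map_cons]
      generalize pos p w = k at *
      by_cases h4 : i < p
      · simp only [h4, if_true, true_or] at hk1 ⊢
        have e : lift k i = i := by simp only [lift]; split_ifs <;> omega
        rw [e]
        exact reach_range_commute (i := i) _ (by omega)
      · simp only [h4, if_false, false_or] at hk1 ⊢
        obtain ⟨j, rfl⟩ : ∃ j, i = j + 1 := ⟨i - 1, by omega⟩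
        simp only [Nat.add_sub_cancel] at hk1 ⊢
        by_cases h5 : k < j + 1
        · simp only [h5, if_true]
          have e : lift k j = j + 1 := by simp only [lift]; split_ifs <;> omega
          rw [e]
          exact reach_range_commute (i := j + 1) _ (by omega)
        · simp only [h5, if_false]
          have e : lift k j = j := by simp only [lift]; split_ifs <;> omega
          rw [e]
          exact reach_range_braid (i := j) _ (by omega) (by omega)

/-- The number of codimension two intersections that involve a strand moving from position `0`
to position `k` and one of the crossings of the word `w` of the other strands. -/
def crossCount (k : ℕ) (w : List ℕ) : ℕ := (w.map fun j => if j + 1 < k then k - 1 else k).sum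

/-- Letter by letter, with final position `k`: a crossing left of the strand costs `(p - 1) + (k -
p)`, one to its right but not beyond `k` costs `p + (k - p - 1)`, and one beyond `k` costs `p + (k -
p)`. -/
theorem postponeCost_add_advanceCost {p : ℕ} {w : List ℕ} (h : Mono p w)
    (hk : ∀ j ∈ proj p w, j + 1 ≠ pos p w) :
    postponeCost p w + advanceCost (pos p w) p w = crossCount (pos p w) (proj p w) := by
  induction w generalizing p with
  | nil => simp [advanceCost, proj, postponeCost, crossCount]
  | cons i w ih =>
    have hp := le_pos h
    simp only [Mono, pos, proj, advanceCost, postponeCost] at *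
    by_cases h1 : i = p
    · subst h1
      simp only [if_true] at h hk hp ⊢
      exact ih h hk
    · simp only [h1, if_false] at h hk hp ⊢
      obtain ⟨h2, h3⟩ := h
      simp only [h2, if_false] at hk hp ⊢
      have hk1 := hk _ (List.mem_cons_self ..)
      have := ih h3 fun j hj => hk j (List.mem_cons_of_mem _ hj)
      simp only [crossCount, List.map_cons, List.sum_cons] at *
      generalize pos p w = k at *
      split_ifs at * <;> omega

theorem length_eq_of_mono {p : ℕ} {w : List ℕ} (h : Mono p w) :
    w.length + p = (proj p w).length + pos p w := by
  induction w generalizing p with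
  | nil => rfl
  | cons i w ih =>
    simp only [Mono, pos, proj] at *
    split_ifs at h ⊢ with h1 h2
    · have := ih h
      simp only [List.length_cons]
      omega
    · exact absurd h2 h.1
    all_goals
      have := ih h.2
      simp only [List.length_cons]
      omega

/-- The letters missing from the projection are the steps of the strand; their number is at least
its displacement, with equality only if no step goes left. -/
theorem le_length (p : ℕ) (w : List ℕ) :
    (proj p w).length + pos p w ≤ w.length + p ∧
      (w.length + p ≤ (proj p w).length + pos p w → Mono p w) := by
  induction w generalizing p with
  | nil => simp [Mono, proj, pos]
  | cons i w ih =>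
    simp only [Mono, pos, proj] at *
    split_ifs with h1 h2
    · have := ih (p + 1)
      simp only [List.length_cons]
      refine ⟨by omega, fun h => this.2 (by omega)⟩
    · have := ih i
      simp only [List.length_cons]
      refine ⟨by omega, fun h => by omega⟩
    all_goals
      have := ih p
      simp only [List.length_cons]
      refine ⟨by omega, fun h => ⟨h2, this.2 (by omega)⟩⟩

/-- If the strand enters at `j`, it crosses both others, whose mutual crossing survives with the
same letter but passes from one side of the strand to the other: its cost is `j + 1` or `j`.
Entering at `j + 1` or `j + 2` forces a step to the left; otherwise the strand is not involved and
the braid move survives. -/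
theorem proj_braid (p j : ℕ) (v : List ℕ) :
    (Mono p (j :: (j + 1) :: j :: v) ↔ Mono p ((j + 1) :: j :: (j + 1) :: v)) ∧
    (Mono p (j :: (j + 1) :: j :: v) →
      pos p ((j + 1) :: j :: (j + 1) :: v) = pos p (j :: (j + 1) :: j :: v) ∧
      ((Step (proj p (j :: (j + 1) :: j :: v)) (proj p ((j + 1) :: j :: (j + 1) :: v)) ∧
          postponeCost p (j :: (j + 1) :: j :: v) =
            postponeCost p ((j + 1) :: j :: (j + 1) :: v)) ∨
        (proj p (j :: (j + 1) :: j :: v) = proj p ((j + 1) :: j :: (j + 1) :: v) ∧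
          postponeCost p (j :: (j + 1) :: j :: v) ≤
            postponeCost p ((j + 1) :: j :: (j + 1) :: v) + 1 ∧
          postponeCost p ((j + 1) :: j :: (j + 1) :: v) ≤
            postponeCost p (j :: (j + 1) :: j :: v) + 1))) := by
  by_cases h1 : j = p
  · subst h1
    have h3 : j ≠ j + 1 + 1 := by omega
    have h5 : j < j + 1 + 1 := by omega
    simp [Mono, pos, proj, postponeCost, h3, h3.symm, h5]
    exact fun _ => by omega
  · by_cases h2 : j + 1 = p
    · subst h2
      have h3 : j ≠ j + 1 + 1 := by omega
      simp [Mono, h3]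
    · by_cases h3 : j + 1 + 1 = p
      · subst h3
        have h4 : j ≠ j + 1 + 1 := by omega
        simp [Mono, h4]
      · simp only [Mono, pos, proj, postponeCost, h1, h2, h3, if_false]
        refine ⟨by tauto, fun _ => ⟨trivial, .inl ⟨.braid _ _ _ ?_, ?_⟩⟩⟩ <;>
          split_ifs <;> omega

/-- A move either is a move of the word of the other strands, or it fixes that word and changes
`postponeCost` by one. -/
theorem Step.proj {p : ℕ} {w w' : List ℕ} (h : Step w w') (hw : Mono p w) :
    Mono p w' ∧ pos p w' = pos p w ∧
      ((Step (proj p w) (proj p w') ∧ postponeCost p w' = postponeCost p w) ∨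
        (RedWord.proj p w' = RedWord.proj p w ∧ postponeCost p w' ≤ postponeCost p w + 1)) := by
  induction h generalizing p with
  | comm j k v h =>
    simp only [Mono, pos, RedWord.proj, postponeCost] at hw ⊢
    by_cases h1 : j = p
    · have h2 : k ≠ p := by omega
      have h3 : k ≠ p + 1 := by omega
      have h4 : k + 1 ≠ p := by omega
      have h5 : k ≠ p := by omega
      subst h1
      simp only [h2, h3, h4, if_true, if_false, Nat.add_right_cancel_iff, ne_eq, not_false_eq_true,
        true_and] at hw ⊢
      refine ⟨hw, .inr ⟨?_, ?_⟩⟩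
      · congr 1
        split_ifs <;> omega
      · split_ifs <;> omega
    · by_cases h2 : k = p
      · have h3 : j ≠ p + 1 := by omega
        have h4 : j + 1 ≠ p := by omega
        subst h2
        simp only [h1, h3, h4, if_true, if_false, Nat.add_right_cancel_iff, ne_eq,
          not_false_eq_true, true_and] at hw ⊢
        refine ⟨hw, .inr ⟨?_, ?_⟩⟩
        · congr 1
          split_ifs <;> omega
        · split_ifs <;> omega
      · simp only [h1, h2, if_false] at hw ⊢
        obtain ⟨h3, h4, h5⟩ := hw
        simp only [h3, h4, if_false]
        refine ⟨⟨h4, h3, h5⟩, trivial, .inl ⟨.comm _ _ _ ?_, by omega⟩⟩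
        split_ifs <;> omega
  | braid j k v h =>
    rcases h with rfl | rfl
    · obtain ⟨h1, h2⟩ := proj_braid p j v
      obtain ⟨h3, h4⟩ := h2 hw
      refine ⟨h1.1 hw, h3, h4.imp (fun h => ⟨h.1, h.2.symm⟩) (fun h => ⟨h.1.symm, h.2.2⟩)⟩
    · obtain ⟨h1, h2⟩ := proj_braid p k v
      obtain ⟨h3, h4⟩ := h2 (h1.2 hw)
      refine ⟨h1.2 hw, h3.symm, h4.imp (fun h => ⟨h.1.symm, h.2⟩) (fun h => ⟨h.1, h.2.1⟩)⟩
  | cons i h ih =>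
    simp only [Mono, pos, RedWord.proj, postponeCost] at hw ⊢
    by_cases h1 : i = p
    · subst h1
      simp only [if_true] at hw ⊢
      exact ih hw
    · simp only [h1, if_false] at hw ⊢
      obtain ⟨h2, h3⟩ := hw
      simp only [h2, if_false]
      obtain ⟨h4, h5, h6⟩ := ih h3
      refine ⟨⟨h2, h4⟩, h5, ?_⟩
      rcases h6 with ⟨h6, h7⟩ | ⟨h6, h7⟩
      · exact .inl ⟨.cons _ h6, by rw [h7]⟩
      · exact .inr ⟨by rw [h6], by omega⟩

/-! ### Reduced words in terms of codes -/

/-- The reduced words with given code: the head of the code is the final position of the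
smallest value, the tail is the code of the permutation of the other values. -/
def Red : List ℕ → List ℕ → Prop
  | [], w => w = []
  | k :: c, w => Mono 0 w ∧ pos 0 w = k ∧ Red c (proj 0 w)

/-- The permutation with code `c` preserves the set of the first `k` values. -/
def Splits : ℕ → List ℕ → Prop
  | 0, _ => True
  | _ + 1, [] => True
  | k + 1, m :: c => m ≤ k ∧ Splits k c

/-- The codes of the permutations that avoid `312`. -/
def Good : List ℕ → Prop
  | [] => True
  | k :: c => Splits k c ∧ Good c

/-- The number of moves needed to bring a word to the form in which the small values move last. -/
def potential : List ℕ → List ℕ → ℕ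
  | [], _ => 0
  | _ :: c, w => postponeCost 0 w + potential c (proj 0 w)

/-- The diameter of the graph of reduced words, in terms of the code. -/
def codeDiam : List ℕ → ℕ
  | [] => 0
  | k :: c => (k - 1) * (c.take k).sum + k * (c.drop k).sum + codeDiam c

/-- The reduced word in which the small values move last. -/
def lastWord : List ℕ → List ℕ
  | [] => []
  | k :: c => (lastWord c).map (· + 1) ++ List.range' 0 k

/-- The reduced word in which the small values move first. -/
def firstWord : List ℕ → List ℕ
  | [] => []
  | k :: c => List.range' 0 k ++ (firstWord c).map (lift k)

theorem Red.length_eq {c w : List ℕ} (h : Red c w) : w.length = c.sum := by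
  induction c generalizing w with
  | nil => simp [show w = [] from h]
  | cons k c ih =>
    obtain ⟨h1, rfl, h3⟩ := h
    have := length_eq_of_mono h1
    rw [List.sum_cons, ← ih h3]
    omega

/-- Restoring a strand that stays within positions up to `k` enlarges the left block by one
position, so the forbidden letter shifts from `k - 1` to `k`. The new letters below `k` are the
steps of the strand. -/
theorem splits_aux {k p : ℕ} {w : List ℕ} (h : Mono p w) (hk : pos p w ≤ k)
    (hj : ∀ j ∈ proj p w, j + 1 ≠ k) :
    (∀ i ∈ w, i ≠ k) ∧ w.countP (· < k) + p = pos p w + (proj p w).countP (· + 1 < k) := by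
  induction w generalizing p with
  | nil => simp [proj, pos]
  | cons i w ih =>
    have hp := le_pos h
    simp only [Mono, pos, proj] at h hk hj hp ⊢
    by_cases h1 : i = p
    · subst h1
      simp only [if_true] at h hk hj hp ⊢
      have hp' := le_pos h
      obtain ⟨h2, h3⟩ := ih h hk hj
      have h4 : i < k := by omega
      refine ⟨by simpa [h4.ne] using h2, ?_⟩
      simp only [List.countP_cons, h4, decide_true, if_true]
      omega
    · simp only [h1, if_false] at h hk hj hp ⊢
      obtain ⟨h2, h3⟩ := h
      simp only [h2, if_false] at hk hj hp ⊢
      have hj1 := hj _ (List.mem_cons_self ..)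
      obtain ⟨h4, h5⟩ := ih h3 hk fun j h => hj j (List.mem_cons_of_mem _ h)
      have h6 : i ≠ k := by split_ifs at hj1 <;> omega
      refine ⟨by simpa [h6] using h4, ?_⟩
      have h7 : i < k ↔ (if i < p then i else i - 1) + 1 < k := by split_ifs <;> omega
      simp only [List.countP_cons, ← h7]
      omega

theorem Splits.letters {k : ℕ} {c w : List ℕ} (hk : Splits k c) (h : Red c w) :
    (∀ i ∈ w, i + 1 ≠ k) ∧ w.countP (· + 1 < k) = (c.take k).sum := by
  induction c generalizing w k with
  | nil => simp [show w = [] from h]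
  | cons m c ih =>
    cases k with
    | zero => simp
    | succ k =>
      obtain ⟨h1, h2, h3⟩ := h
      obtain ⟨h4, h5⟩ := ih hk.2 h3
      obtain ⟨h6, h7⟩ := splits_aux h1 (h2.trans_le hk.1) h4
      refine ⟨fun i hi => by have := h6 i hi; omega, ?_⟩
      simp only [Nat.add_lt_add_iff_right, List.take_succ_cons, List.sum_cons, ← h5, ← h2]
      omega

theorem crossCount_eq {k : ℕ} {c w : List ℕ} (hk : Splits k c) (h : Red c w) :
    crossCount k w = (k - 1) * (c.take k).sum + k * (c.drop k).sum := by
  have h1 := (hk.letters h).2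
  have h2 := h.length_eq
  rw [← List.take_append_drop k c, List.sum_append, ← h1] at h2
  rw [← h1]
  have h3 : crossCount k w =
      (k - 1) * w.countP (· + 1 < k) + k * (w.length - w.countP (· + 1 < k)) := by
    clear h h1 h2
    induction w with
    | nil => simp [crossCount]
    | cons j w ih =>
      have := List.countP_le_length (p := fun j => decide (j + 1 < k)) (l := w)
      simp only [crossCount, List.map_cons, List.sum_cons, List.countP_cons,
        List.length_cons] at ih ⊢
      rw [ih]
      by_cases h : j + 1 < k
      · simp only [h, if_true, decide_true, Nat.add_sub_add_right]
        ring
      · simp only [h, if_false, decide_false, Bool.false_eq_true, Nat.add_zero,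
          Nat.succ_sub this, Nat.mul_succ]
        ring
  rw [h3]
  congr 2
  omega

theorem Step.red {c w w' : List ℕ} (h : Step w w') (hw : Red c w) :
    Red c w' ∧ potential c w' ≤ potential c w + 1 := by
  induction c generalizing w w' with
  | nil => rw [show w = [] from hw] at h; cases h
  | cons k c ih =>
    obtain ⟨h1, h2, h3⟩ := hw
    obtain ⟨h4, h5, h6⟩ := h.proj h1
    simp only [Red, potential]
    -- Exactly one summand of the potential can change: the deeper ones if the move survives
    -- deletion, the outer one if it does not.
    rcases h6 with ⟨h6, h7⟩ | ⟨h6, h7⟩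
    · obtain ⟨h8, h9⟩ := ih h6 h3
      exact ⟨⟨h4, h5.trans h2, h8⟩, by omega⟩
    · rw [h6]
      exact ⟨⟨h4, h5.trans h2, h3⟩, by omega⟩

/-! ### The extremal words and the distances to them -/

theorem map_succ_append (u v : List ℕ) :
    (Mono 0 (u.map (· + 1) ++ v) ↔ Mono 0 v) ∧ pos 0 (u.map (· + 1) ++ v) = pos 0 v ∧
      proj 0 (u.map (· + 1) ++ v) = u ++ proj 0 v ∧
      postponeCost 0 (u.map (· + 1) ++ v) = postponeCost 0 v := by
  induction u with
  | nil => simp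
  | cons j u ih => simpa [Mono, pos, proj, postponeCost] using ih

theorem range_append (p m : ℕ) (v : List ℕ) :
    (Mono p (List.range' p m ++ v) ↔ Mono (p + m) v) ∧
      pos p (List.range' p m ++ v) = pos (p + m) v ∧
      proj p (List.range' p m ++ v) = proj (p + m) v ∧
      postponeCost p (List.range' p m ++ v) = postponeCost (p + m) v := by
  induction m generalizing p with
  | zero => simp
  | succ m ih =>
    have := ih (p + 1)
    rw [Nat.add_right_comm, Nat.add_assoc] at this
    simpa [List.range'_succ, Mono, pos, proj, postponeCost] using this

/-- The strand rests at its final position throughout, so postponing must pay the whole of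
`crossCount`. -/
theorem map_lift_eq {k : ℕ} {u : List ℕ} (hu : ∀ j ∈ u, j + 1 ≠ k) :
    Mono k (u.map (lift k)) ∧ pos k (u.map (lift k)) = k ∧ proj k (u.map (lift k)) = u ∧
      postponeCost k (u.map (lift k)) = crossCount k u := by
  induction u with
  | nil => simp [Mono, pos, proj, postponeCost, crossCount]
  | cons j u ih =>
    have hj := hu j (by simp)
    obtain ⟨h1, h2, h3, h4⟩ := ih fun i hi => hu i (by simp [hi])
    have e : lift k j ≠ k ∧ lift k j + 1 ≠ k ∧
        (if lift k j < k then lift k j else lift k j - 1) = j ∧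
        (if lift k j < k then k - 1 else k) = (if j + 1 < k then k - 1 else k) := by
      simp only [lift]
      split_ifs <;> omega
    obtain ⟨e1, e2, e3, e4⟩ := e
    simp only [List.map_cons, Mono, pos, proj, postponeCost, e1, e2, if_false, e3, e4, h2, h3, h4]
    exact ⟨⟨e2, h1⟩, trivial, trivial, by simp [crossCount]⟩

theorem red_lastWord (c : List ℕ) : Red c (lastWord c) ∧ potential c (lastWord c) = 0 := by
  induction c with
  | nil => simp [Red, lastWord, potential]
  | cons k c ih =>
    obtain ⟨h1, h2, h3, h4⟩ := map_succ_append (lastWord c) (List.range' 0 k)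
    obtain ⟨g1, g2, g3, g4⟩ := range_append 0 k []
    simp only [List.append_nil, Nat.zero_add] at g1 g2 g3 g4
    simp only [Red, lastWord, potential, h1, h2, h3, h4, g1, g2, g3, g4]
    simpa [Mono, pos, proj, postponeCost] using ih

theorem red_firstWord {c : List ℕ} (h : Good c) :
    Red c (firstWord c) ∧ potential c (firstWord c) = codeDiam c := by
  induction c with
  | nil => simp [Red, firstWord, potential, codeDiam]
  | cons k c ih =>
    obtain ⟨h1, h2⟩ := ih h.2
    obtain ⟨g1, g2, g3, g4⟩ := range_append 0 k ((firstWord c).map (lift k))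
    obtain ⟨e1, e2, e3, e4⟩ := map_lift_eq (h.1.letters h1).1
    simp only [Nat.zero_add] at g1 g2 g3 g4
    simp only [Red, firstWord, potential, codeDiam, g1, g2, g3, g4, e1, e2, e3, e4, h1, h2,
      crossCount_eq h.1 h1]
    simp

theorem reach_lastWord {c w : List ℕ} (h : Red c w) : Reach (potential c w) w (lastWord c) := by
  induction c generalizing w with
  | nil => exact .of_eq h
  | cons k c ih =>
    obtain ⟨h1, rfl, h3⟩ := h
    have := reach_postpone h1
    refine Reach.trans this ?_
    -- No letter straddles position 0, so postponing needs no hypothesis on the code.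
    have := (ih h3).map_lift (k := 0) (by simp)
    have e : lift 0 = (· + 1) := by ext; simp [lift]
    rw [e] at this
    exact this.append_right _

theorem reach_firstWord {c w : List ℕ} (hc : Good c) (h : Red c w) :
    potential c w ≤ codeDiam c ∧ Reach (codeDiam c - potential c w) w (firstWord c) := by
  induction c generalizing w with
  | nil => exact ⟨le_rfl, .of_eq h⟩
  | cons k c ih =>
    obtain ⟨h1, rfl, h3⟩ := h
    obtain ⟨h4, h5⟩ := ih hc.2 h3
    have h6 := (hc.1.letters h3).1
    have h7 := postponeCost_add_advanceCost h1 h6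
    rw [crossCount_eq hc.1 h3] at h7
    have h8 := (reach_advance h1 h6).trans ((h5.map_lift h6).append_left _)
    simp only [codeDiam, potential, firstWord, ← h7]
    refine ⟨by omega, ?_⟩
    rw [Nat.sub_zero] at h8
    convert h8 using 1
    omega

/-- The code of a permutation of `c.length` elements. -/
def Bounded : List ℕ → Prop
  | [] => True
  | k :: c => k ≤ c.length ∧ Bounded c

theorem Bounded.lastWord_lt {c : List ℕ} (h : Bounded c) :
    ∀ i ∈ lastWord c, i + 1 < c.length := by
  induction c with
  | nil => simp [lastWord]
  | cons k c ih =>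
    have h1 := h.1
    have h2 := ih h.2
    intro i hi
    simp only [lastWord, List.mem_append, List.mem_map, List.mem_range'_1] at hi
    rw [List.length_cons]
    rcases hi with ⟨j, hj, rfl⟩ | hi
    · have := h2 j hj
      omega
    · omega

theorem Bounded.firstWord_lt {c : List ℕ} (h : Bounded c) :
    ∀ i ∈ firstWord c, i + 1 < c.length := by
  induction c with
  | nil => simp [firstWord]
  | cons k c ih =>
    have h1 := h.1
    have h2 := ih h.2
    intro i hi
    simp only [firstWord, List.mem_append, List.mem_map, List.mem_range'_1] at hi
    rw [List.length_cons]
    rcases hi with hi | ⟨j, hj, rfl⟩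
    · omega
    · have := h2 j hj
      unfold lift
      split_ifs <;> omega

/-! ### Words as functions -/

/-- The one-line notation of the product of the simple reflections of a word. -/
def wordFun : List ℕ → ℕ → ℕ
  | [] => id
  | i :: w => Equiv.swap i (i + 1) ∘ wordFun w

/-- Insert a new smallest value in position `p` in the one-line notation `f`. -/
def insertMin (p : ℕ) (f : ℕ → ℕ) (x : ℕ) : ℕ :=
  if x = p then 0 else if x < p then f x + 1 else f (x - 1) + 1

/-- The one-line notation of the permutation with code `c`. -/
def codeFun : List ℕ → ℕ → ℕ
  | [] => id
  | k :: c => insertMin k (codeFun c)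

theorem insertMin_injective {p q : ℕ} {f g : ℕ → ℕ} (h : insertMin p f = insertMin q g) :
    p = q ∧ f = g := by
  have hpq : p = q := by
    have := congrFun h p
    simp only [insertMin, if_true] at this
    split_ifs at this with h1
    exact h1
  subst hpq
  refine ⟨rfl, funext fun x => ?_⟩
  by_cases hx : x < p
  · have := congrFun h x
    simpa [insertMin, hx, hx.ne] using this
  · have h1 : x + 1 ≠ p := by omega
    have h2 : ¬ x + 1 < p := by omega
    have := congrFun h (x + 1)
    simpa [insertMin, h1, h2] using this

theorem swap_succ_apply (i x : ℕ) :
    Equiv.swap i (i + 1) x = if x = i then i + 1 else if x = i + 1 then i else x := by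
  rw [Equiv.swap_apply_def]

theorem insertMin_comp_swap_right (p : ℕ) (f : ℕ → ℕ) :
    insertMin p f ∘ Equiv.swap p (p + 1) = insertMin (p + 1) f := by
  ext x
  simp only [Function.comp_apply, swap_succ_apply, insertMin]
  grind

theorem insertMin_comp_swap_left (p : ℕ) (f : ℕ → ℕ) :
    insertMin (p + 1) f ∘ Equiv.swap p (p + 1) = insertMin p f := by
  ext x
  simp only [Function.comp_apply, swap_succ_apply, insertMin]
  grind

theorem insertMin_comp_swap {i p : ℕ} (h : i ≠ p) (h' : i + 1 ≠ p) (f : ℕ → ℕ) :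
    insertMin p f ∘ Equiv.swap i (i + 1) =
      insertMin p (f ∘ Equiv.swap (if i < p then i else i - 1)
        ((if i < p then i else i - 1) + 1)) := by
  ext x
  by_cases hi : i < p
  · simp only [Function.comp_apply, swap_succ_apply, insertMin, hi, if_true]
    grind
  · obtain ⟨j, rfl⟩ : ∃ j, i = j + 1 := ⟨i - 1, by omega⟩
    simp only [Function.comp_apply, swap_succ_apply, insertMin, hi, if_false]
    grind

/-- Composition on the right exchanges positions, so each letter either moves the inserted minimum
or acts on `f` through the renamed letter of `proj`. -/
theorem insertMin_comp_wordFun (p : ℕ) (f : ℕ → ℕ) (w : List ℕ) :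
    insertMin p f ∘ wordFun w = insertMin (pos p w) (f ∘ wordFun (proj p w)) := by
  induction w generalizing p f with
  | nil => rfl
  | cons i w ih =>
    simp only [wordFun, pos, proj, ← Function.comp_assoc]
    by_cases h1 : i = p
    · subst h1
      simp only [if_true, insertMin_comp_swap_right, ih]
    · by_cases h2 : i + 1 = p
      · subst h2
        simp only [h1, if_true, if_false, insertMin_comp_swap_left, ih]
      · simp only [h1, h2, if_false, insertMin_comp_swap h1 h2, ih, wordFun,
          Function.comp_assoc]

theorem wordFun_eq (w : List ℕ) : wordFun w = insertMin (pos 0 w) (wordFun (proj 0 w)) := by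
  have h : insertMin 0 id = id := by
    ext x
    simp only [insertMin, id]
    split_ifs <;> omega
  simpa [h] using insertMin_comp_wordFun 0 id w

theorem Red.wordFun_eq {c w : List ℕ} (h : Red c w) : wordFun w = codeFun c := by
  induction c generalizing w with
  | nil => rw [show w = [] from h]; rfl
  | cons k c ih =>
    obtain ⟨_, rfl, h3⟩ := h
    rw [RedWord.wordFun_eq, ih h3, codeFun]

/-- A function determines where the minimum was inserted and what remains, so `le_length` can be
applied once per entry of the code. -/
theorem sum_le_length {c w : List ℕ} (h : wordFun w = codeFun c) :
    c.sum ≤ w.length ∧ (w.length ≤ c.sum → Red c w) := by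
  induction c generalizing w with
  | nil => simp [Red]
  | cons k c ih =>
    rw [RedWord.wordFun_eq, codeFun] at h
    obtain ⟨rfl, h2⟩ := insertMin_injective h
    obtain ⟨h3, h4⟩ := ih h2
    obtain ⟨h5, h6⟩ := le_length 0 w
    rw [List.sum_cons]
    exact ⟨by omega, fun h7 => ⟨h6 (by omega), rfl, h4 (by omega)⟩⟩

/-- The one-line notation of a permutation of `Fin n`, extended by the identity. -/
def permFun {n : ℕ} (π : Equiv.Perm (Fin n)) (x : ℕ) : ℕ :=
  if h : x < n then π ⟨x, h⟩ else x

theorem permFun_apply {n : ℕ} (π : Equiv.Perm (Fin n)) (x : Fin n) : permFun π x = π x := by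
  simp [permFun]

theorem permFun_injective {n : ℕ} : Function.Injective (permFun (n := n)) := by
  intro π σ h
  ext x
  rw [← permFun_apply, h, permFun_apply]

theorem permFun_mul {n : ℕ} (π σ : Equiv.Perm (Fin n)) :
    permFun (π * σ) = permFun π ∘ permFun σ := by
  ext x
  by_cases h : x < n <;> simp [permFun, h]

theorem permFun_simpleRefl {n : ℕ} (i : Fin (n - 1)) :
    permFun (simpleRefl i : Equiv.Perm (Fin n)) = Equiv.swap i.1 (i.1 + 1) := by
  ext x
  have := i.2
  rw [swap_succ_apply]
  by_cases h : x < n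
  · simp only [permFun, h, dif_pos, simpleRefl, Equiv.swap_apply_def, Fin.mk.injEq]
    split_ifs <;> rfl
  · simp only [permFun, h, dif_neg, not_false_eq_true]
    split_ifs <;> omega

theorem permFun_wordProd {n : ℕ} (w : List (Fin (n - 1))) :
    permFun (wordProd w : Equiv.Perm (Fin n)) = wordFun (w.map Fin.val) := by
  induction w with
  | nil => ext x; simp [wordProd, wordFun, permFun]
  | cons i w ih =>
    have : (wordProd (i :: w) : Equiv.Perm (Fin n)) = simpleRefl i * wordProd w := by
      simp [wordProd]
    rw [this, permFun_mul, ih, permFun_simpleRefl, List.map_cons, wordFun]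

theorem exists_fin_word {m : ℕ} {w : List ℕ} (h : ∀ i ∈ w, i < m) :
    ∃ w' : List (Fin m), w'.map Fin.val = w :=
  ⟨w.pmap Fin.mk h, by simp [List.map_pmap]⟩

/-- The code `c` describes the permutation `π`. -/
structure IsCode {n : ℕ} (π : Equiv.Perm (Fin n)) (c : List ℕ) : Prop where
  length_eq : c.length = n
  bounded : Bounded c
  permFun_eq : permFun π = codeFun c

theorem IsCode.isReducedWord_iff {n : ℕ} {π : Equiv.Perm (Fin n)} {c : List ℕ} (h : IsCode π c)
    (w : List (Fin (n - 1))) : IsReducedWord π w ↔ Red c (w.map Fin.val) := by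
  have hw : ∀ v : List (Fin (n - 1)), wordProd v = π ↔ wordFun (v.map Fin.val) = codeFun c := by
    intro v
    rw [← permFun_injective.eq_iff, permFun_wordProd, h.permFun_eq]
  obtain ⟨v, hv⟩ := exists_fin_word (m := n - 1) (w := lastWord c) (by
    intro i hi
    have := h.bounded.lastWord_lt i hi
    have := h.length_eq
    omega)
  have hr := (red_lastWord c).1
  rw [← hv] at hr
  constructor
  · rintro ⟨h1, h2⟩
    refine (sum_le_length ((hw w).1 h1)).2 ?_
    have := h2 v ((hw v).2 hr.wordFun_eq)
    have := hr.length_eq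
    simp only [List.length_map] at *
    omega
  · intro h1
    refine ⟨(hw w).2 h1.wordFun_eq, fun v hv => ?_⟩
    have := (sum_le_length ((hw v).1 hv)).1
    have := h1.length_eq
    simp only [List.length_map] at *
    omega

/-! ### The graph of reduced words -/

theorem step_map_val_iff {m : ℕ} {w w' : List (Fin m)} :
    Step (w.map Fin.val) (w'.map Fin.val) ↔ CommMove w w' ∨ BraidMove w w' := by
  constructor
  · intro h
    generalize hu : w.map Fin.val = u at h
    generalize hu' : w'.map Fin.val = u' at h
    have hi : Function.Injective (List.map (Fin.val (n := m))) :=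
      List.map_injective_iff.2 Fin.val_injective
    induction h generalizing w w' with
    | comm j k v h =>
      match w, hu with
      | j :: k :: v, hu =>
        obtain rfl : w' = k :: j :: v := hi (by rw [hu']; simp_all)
        simp only [List.map_cons, List.cons.injEq] at hu
        exact .inl (.mk [] v j k (by omega))
    | braid j k v h =>
      match w, hu with
      | j :: k :: l :: v, hu =>
        simp only [List.map_cons, List.cons.injEq] at hu
        obtain rfl : l = j := Fin.ext (by omega)
        obtain rfl : w' = k :: l :: k :: v := hi (by rw [hu']; simp_all)
        exact .inr (.mk [] v l k (by omega))
    | cons i h ih =>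
      match w, w', hu, hu' with
      | i :: w, j :: w', hu, hu' =>
        simp only [List.map_cons, List.cons.injEq] at hu hu'
        obtain rfl : i = j := Fin.ext (by omega)
        rcases ih hu.2 hu'.2 with ⟨u, v, j, k, h⟩ | ⟨u, v, j, k, h⟩
        · exact .inl (.mk (i :: u) v j k h)
        · exact .inr (.mk (i :: u) v j k h)
  · rintro (⟨u, v, j, k, h⟩ | ⟨u, v, j, k, h⟩)
    · simp only [List.map_append, List.append_assoc]
      exact (Step.comm j.1 k.1 (v.map Fin.val) h).append_left _
    · simp only [List.map_append, List.append_assoc]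
      exact (Step.braid j.1 k.1 (v.map Fin.val) h).append_left _

theorem IsCode.edist_le {n : ℕ} {π : Equiv.Perm (Fin n)} {c : List ℕ} (h : IsCode π c)
    {w w' : R π} {d : ℕ} (hd : Reach d (w.1.map Fin.val) (w'.1.map Fin.val)) :
    (G π).edist w w' ≤ d := by
  generalize hu : w.1.map Fin.val = u at hd
  generalize hu' : w'.1.map Fin.val = u' at hd
  induction hd generalizing w with
  | refl u =>
    have hi : Function.Injective (List.map (Fin.val (n := n - 1))) :=
      List.map_injective_iff.2 Fin.val_injective
    rw [Subtype.ext (hi (hu.trans hu'.symm)), SimpleGraph.edist_self]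
    exact zero_le
  | @head d u v z hs hd ih =>
    obtain ⟨x, rfl⟩ := exists_fin_word (m := n - 1) (w := v) (by
      intro i hi
      rw [hs.mem_iff, ← hu, List.mem_map] at hi
      obtain ⟨a, _, rfl⟩ := hi
      exact a.2)
    rw [← hu] at hs
    -- Moves preserve `Red`, so the path never leaves the reduced words of `π`.
    have hx : IsReducedWord π x :=
      (h.isReducedWord_iff x).2 (hs.red ((h.isReducedWord_iff w.1).1 w.2)).1
    have hadj : (G π).Adj w ⟨x, hx⟩ := step_map_val_iff.1 hs
    refine (SimpleGraph.edist_triangle (v := ⟨x, hx⟩)).trans ?_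
    rw [SimpleGraph.edist_eq_one_iff_adj.2 hadj, Nat.cast_add, Nat.cast_one, add_comm]
    gcongr
    exact ih rfl hu'

theorem IsCode.le_edist {n : ℕ} {π : Equiv.Perm (Fin n)} {c : List ℕ} (h : IsCode π c)
    (w w' : R π) : (potential c (w.1.map Fin.val) : ℕ∞) ≤
      potential c (w'.1.map Fin.val) + (G π).edist w w' := by
  rw [SimpleGraph.edist, ENat.add_iInf]
  refine le_iInf fun p => ?_
  norm_cast
  induction p with
  | nil => simp
  | @cons u v z hadj p ih =>
    have := ((step_map_val_iff.2 hadj.symm).red ((h.isReducedWord_iff v.1).1 v.2)).2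
    rw [SimpleGraph.Walk.length_cons]
    omega

theorem IsCode.ediam_eq {n : ℕ} {π : Equiv.Perm (Fin n)} {c : List ℕ} (h : IsCode π c)
    (hc : Good c) : (G π).ediam = codeDiam c := by
  have hl : ∀ i ∈ lastWord c, i < n - 1 := fun i hi => by
    have := h.bounded.lastWord_lt i hi
    have := h.length_eq
    omega
  have hf : ∀ i ∈ firstWord c, i < n - 1 := fun i hi => by
    have := h.bounded.firstWord_lt i hi
    have := h.length_eq
    omega
  obtain ⟨l, hl⟩ := exists_fin_word hl
  obtain ⟨f, hf⟩ := exists_fin_word hf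
  obtain ⟨hl1, hl2⟩ := red_lastWord c
  obtain ⟨hf1, hf2⟩ := red_firstWord hc
  apply le_antisymm
  · refine SimpleGraph.ediam_le_of_edist_le fun w w' => ?_
    have hw := (h.isReducedWord_iff w.1).1 w.2
    have hw' := (h.isReducedWord_iff w'.1).1 w'.2
    have h1 := h.edist_le (w := w) (w' := w') ((reach_lastWord hw).trans (reach_lastWord hw').symm)
    obtain ⟨h2, h3⟩ := reach_firstWord hc hw
    obtain ⟨h4, h5⟩ := reach_firstWord hc hw'
    have h6 := h.edist_le (w := w) (w' := w') (h3.trans h5.symm)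
    -- The shorter of the routes through `lastWord` and `firstWord` has at most `codeDiam c` moves.
    rcases le_total (potential c (w.1.map Fin.val) + potential c (w'.1.map Fin.val))
      (codeDiam c) with h7 | h7
    · exact h1.trans (by exact_mod_cast h7)
    · exact h6.trans (by norm_cast; omega)
  · rw [← hl] at hl1 hl2
    rw [← hf] at hf1 hf2
    have := h.le_edist ⟨f, (h.isReducedWord_iff f).2 hf1⟩ ⟨l, (h.isReducedWord_iff l).2 hl1⟩
    simp only [hf2, hl2, Nat.cast_zero, zero_add] at this
    exact this.trans SimpleGraph.edist_le_ediam

/-! ### Counting inversions -/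

/-- The number of inversions of `π` among the first `k` positions. -/
def invBelow {n : ℕ} (k : ℕ) (π : Equiv.Perm (Fin n)) : ℕ :=
  ∑ a : Fin n, ∑ b : Fin n, if IsInversion π a b ∧ b.1 < k then 1 else 0

theorem exists_delete_min {n : ℕ} (π : Equiv.Perm (Fin (n + 1))) :
    ∃ (m : Fin (n + 1)) (σ : Equiv.Perm (Fin n)), π m = 0 ∧
      ∀ j, π (m.succAbove j) = (σ j).succ := by
  have h0 : ∀ j, π ((π.symm 0).succAbove j) ≠ 0 := fun j h => by
    rw [← Equiv.eq_symm_apply] at h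
    exact Fin.succAbove_ne _ _ h
  have hinj : Function.Injective fun j => (π ((π.symm 0).succAbove j)).pred (h0 j) := by
    intro i j h
    simpa using h
  refine ⟨π.symm 0, Equiv.ofBijective _ (Finite.injective_iff_bijective.1 hinj), by simp,
    fun j => by simp⟩

section Delete

variable {n : ℕ} {π : Equiv.Perm (Fin (n + 1))} {m : Fin (n + 1)} {σ : Equiv.Perm (Fin n)}

theorem permFun_eq_insertMin (hm : π m = 0) (hσ : ∀ j, π (m.succAbove j) = (σ j).succ) :
    permFun π = insertMin m (permFun σ) := by
  ext x
  have hmn := m.2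
  by_cases hx : x < n + 1
  · rw [show x = (⟨x, hx⟩ : Fin (n + 1)).1 from rfl, permFun_apply]
    generalize (⟨x, hx⟩ : Fin (n + 1)) = y
    rcases Fin.eq_self_or_eq_succAbove m y with rfl | ⟨j, rfl⟩
    · simp [insertMin, hm]
    · rw [hσ, Fin.val_succ, ← permFun_apply]
      by_cases h : j.castSucc < m
      · rw [Fin.succAbove_of_castSucc_lt _ _ h]
        have h' : j.1 < m.1 := h
        simp [insertMin, h', h'.ne]
      · rw [Fin.succAbove_of_le_castSucc _ _ (not_lt.1 h)]
        have h' : ¬ j.1 < m.1 := h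
        have h1 : j.1 + 1 ≠ m.1 := by omega
        have h2 : ¬ j.1 + 1 < m.1 := by omega
        simp [insertMin, h1, h2]
  · have h1 : x ≠ m.1 := by omega
    have h2 : ¬ x < m.1 := by omega
    have h3 : ¬ x - 1 < n := by omega
    simp only [permFun, hx, dif_neg, not_false_eq_true, insertMin, h1, h2, if_false, h3]
    omega

theorem not_isInversion_min (hm : π m = 0) (j : Fin (n + 1)) : ¬ IsInversion π m j := by
  simp [hm]

theorem isInversion_succAbove_min (hm : π m = 0) (hσ : ∀ j, π (m.succAbove j) = (σ j).succ)
    (i : Fin n) : IsInversion π (m.succAbove i) m ↔ i.1 < m.1 := by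
  simp only [IsInversion, hm, hσ, Fin.succ_pos, and_true, Fin.succAbove_lt_iff_castSucc_lt]
  rfl

theorem isInversion_succAbove (hσ : ∀ j, π (m.succAbove j) = (σ j).succ) (i j : Fin n) :
    IsInversion π (m.succAbove i) (m.succAbove j) ↔ IsInversion σ i j := by
  simp [IsInversion, hσ]

theorem card_lt {k : ℕ} (hk : k ≤ n) : (∑ i : Fin n, if i.1 < k then 1 else 0) = k := by
  rw [← Finset.card_filter, Fin.card_filter_val_lt, min_eq_right hk]

theorem succAbove_lt_succ_iff {k : ℕ} (hk : m.1 ≤ k) (j : Fin n) :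
    (m.succAbove j).1 < k + 1 ↔ j.1 < k := by
  rcases lt_or_ge j.castSucc m with h | h
  · rw [Fin.succAbove_of_castSucc_lt _ _ h]
    have h' : j.1 < m.1 := h
    simp only [Fin.val_castSucc]
    omega
  · rw [Fin.succAbove_of_le_castSucc _ _ h]
    simp

theorem invBelow_succ (hm : π m = 0) (hσ : ∀ j, π (m.succAbove j) = (σ j).succ) {k : ℕ}
    (hk : m.1 ≤ k) : invBelow (k + 1) π = m + invBelow k σ := by
  have h1 : m.1 < k + 1 := by omega
  simp only [invBelow, Fin.sum_univ_succAbove _ m, not_isInversion_min hm,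
    isInversion_succAbove_min hm hσ, isInversion_succAbove hσ, succAbove_lt_succ_iff hk, false_and,
    if_false, Finset.sum_const_zero, Nat.zero_add, add_zero, h1, and_true, Finset.sum_add_distrib,
    card_lt (Nat.lt_succ_iff.1 m.2)]

/-! ### Recursion for |I₂| + |I₃| -/

theorem card_I2_eq {n : ℕ} (π : Equiv.Perm (Fin n)) :
    (I2 π).card = ∑ i, ∑ j, ∑ a, ∑ b, if IsInversion π i j ∧ IsInversion π a b ∧
      (i ≠ a ∧ i ≠ b ∧ j ≠ a ∧ j ≠ b) ∧ i < a then 1 else 0 := by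
  rw [I2, Finset.card_filter]
  simp only [Fintype.sum_prod_type]
  refine Finset.sum_congr rfl fun i _ => Finset.sum_congr rfl fun j _ =>
    Finset.sum_congr rfl fun a _ => Finset.sum_congr rfl fun b _ => ?_
  congr 1
  simp only [Finset.disjoint_insert_left, Finset.disjoint_singleton_left, Finset.mem_insert,
    Finset.mem_singleton, not_or, ne_eq, and_assoc]

theorem card_I3_eq {n : ℕ} (π : Equiv.Perm (Fin n)) :
    (I3 π).card = ∑ i, ∑ j, ∑ k,
      if IsInversion π i j ∧ IsInversion π i k ∧ IsInversion π j k then 1 else 0 := by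
  rw [I3, Finset.card_filter]
  simp only [Fintype.sum_prod_type]

/-- The minimum can only be the last entry of a 321, the other two being an inversion to its left.
-/
theorem card_I3_delete (hm : π m = 0) (hσ : ∀ j, π (m.succAbove j) = (σ j).succ) :
    (I3 π).card = invBelow m σ + (I3 σ).card := by
  simp only [card_I3_eq, Fin.sum_univ_succAbove _ m, not_isInversion_min hm,
    isInversion_succAbove_min hm hσ, isInversion_succAbove hσ, false_and, and_false,
    if_false, Finset.sum_const_zero, Nat.zero_add, add_zero, Finset.sum_add_distrib, invBelow]
  congr 1
  refine Finset.sum_congr rfl fun i _ => Finset.sum_congr rfl fun j _ => ?_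
  congr 1
  simp only [IsInversion, eq_iff_iff]
  constructor
  · tauto
  · rintro ⟨⟨h1, h2⟩, h3⟩
    exact ⟨⟨h1, h2⟩, lt_trans h1 h3, h3⟩

theorem card_I2_delete (hm : π m = 0) (hσ : ∀ j, π (m.succAbove j) = (σ j).succ) :
    (I2 π).card = (∑ a, ∑ b, if IsInversion σ a b then
      ∑ i : Fin n, (if i.1 < m.1 ∧ i ≠ a ∧ i ≠ b then 1 else 0) else 0) + (I2 σ).card := by
  have h1 : ∀ i, m.succAbove i ≠ m := Fin.succAbove_ne m
  have h2 : ∀ i, m ≠ m.succAbove i := fun i => (h1 i).symm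
  simp only [card_I2_eq, Fin.sum_univ_succAbove _ m, not_isInversion_min hm,
    isInversion_succAbove_min hm hσ, isInversion_succAbove hσ, false_and, and_false, true_and,
    if_false, Finset.sum_const_zero, Nat.zero_add, add_zero, Finset.sum_add_distrib, ne_eq,
    h1, h2, not_true_eq_false, not_false_eq_true, and_true, Fin.succAbove_lt_succAbove_iff,
    Fin.succAbove_right_inj, ← add_assoc]
  congr 1
  -- Unordered pairs are recorded by the smaller first index, so those containing an inversion `(i,
  -- m)` come as two sums, `i < a` and `a < i`, to be merged.
  have e1 : (∑ i : Fin n, ∑ a : Fin n, ∑ b : Fin n,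
      if i.1 < m.1 ∧ IsInversion σ a b ∧ (¬ i = a ∧ ¬ i = b) ∧ i < a then 1 else 0) =
      ∑ a : Fin n, ∑ b : Fin n, ∑ i : Fin n,
      if i.1 < m.1 ∧ IsInversion σ a b ∧ (¬ i = a ∧ ¬ i = b) ∧ i < a then 1 else 0 := by
    rw [Finset.sum_comm]
    exact Finset.sum_congr rfl fun a _ => Finset.sum_comm
  rw [e1]
  simp only [← Finset.sum_add_distrib]
  refine Finset.sum_congr rfl fun a _ => Finset.sum_congr rfl fun b _ => ?_
  split_ifs with h
  · refine Finset.sum_congr rfl fun i _ => ?_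
    grind
  · simp [h]

/-- Together, the disjoint pairs and the 321 occurrences combining an inversion `(a, b)` with the
minimum at position `k` number `(k - 2) + 1` or `k`, the weights in `codeDiam`. -/
theorem sum_lt_ne {k : ℕ} (hk : k ≤ n) {a b : Fin n} (hab : a < b)
    (h : b.1 < k ∨ k ≤ a.1) :
    (∑ i : Fin n, if i.1 < k ∧ i ≠ a ∧ i ≠ b then 1 else 0) + (if b.1 < k then 1 else 0) =
      if b.1 < k then k - 1 else k := by
  have h0 := card_lt hk
  have hab' : a.1 < b.1 := hab
  rcases h with h | h
  · have ha : a.1 < k := by omega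
    have e : (∑ i : Fin n, if i.1 < k then 1 else 0) =
        (∑ i : Fin n, if i.1 < k ∧ i ≠ a ∧ i ≠ b then 1 else 0) +
        ((∑ i : Fin n, if i = a then 1 else 0) + ∑ i : Fin n, if i = b then 1 else 0) := by
      simp only [← Finset.sum_add_distrib]
      refine Finset.sum_congr rfl fun i _ => ?_
      grind
    simp only [Finset.sum_ite_eq', Finset.mem_univ, if_true] at e
    simp only [h, if_true]
    omega
  · have hb : ¬ b.1 < k := by omega
    simp only [hb, if_false, add_zero]
    rw [← h0]
    refine Finset.sum_congr rfl fun i _ => ?_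
    grind

/-- Every value in the first `k` positions of `π` is smaller than every later value. -/
def Separated {n : ℕ} (k : ℕ) (π : Equiv.Perm (Fin n)) : Prop :=
  ∀ x y : Fin n, x.1 < k → k ≤ y.1 → π x < π y

theorem Separated.delete (hm : π m = 0) (hσ : ∀ j, π (m.succAbove j) = (σ j).succ) {k : ℕ}
    (h : Separated (k + 1) π) : m.1 ≤ k ∧ Separated k σ := by
  have hk : m.1 ≤ k := by
    by_contra! hk
    have := h 0 m (by simp) hk
    simp [hm] at this
  refine ⟨hk, fun x y hx hy => ?_⟩
  have := h (m.succAbove x) (m.succAbove y) ((succAbove_lt_succ_iff hk x).2 hx)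
    (not_lt.1 ((succAbove_lt_succ_iff hk y).not.2 hy.not_gt))
  simpa [hσ] using this

theorem Avoids.delete (hσ : ∀ j, π (m.succAbove j) = (σ j).succ) {k : ℕ}
    {τ : Equiv.Perm (Fin k)} (h : Avoids π τ) : Avoids σ τ := by
  rintro ⟨f, hf⟩
  refine h ⟨f.trans m.succAboveOrderEmb, fun a b => ?_⟩
  simp [hσ, hf]

/-- An inversion across position `m`, with the minimum between its two entries, would be a 312. -/
theorem Avoids.separated (hm : π m = 0) (hσ : ∀ j, π (m.succAbove j) = (σ j).succ)
    (h : Avoids π perm312) : Separated m.1 σ := by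
  intro x y hx hy
  by_contra! hxy
  have hne : x ≠ y := by rintro rfl; omega
  have hlt : σ y < σ x := lt_of_le_of_ne hxy fun e => hne (σ.injective e).symm
  have h1 : m.succAbove x < m := (Fin.succAbove_lt_iff_castSucc_lt _ _).2 hx
  have h2 : m < m.succAbove y := (Fin.lt_succAbove_iff_le_castSucc _ _).2 hy
  refine h ⟨OrderEmbedding.ofStrictMono ![m.succAbove x, m, m.succAbove y] ?_, fun a b => ?_⟩
  · rw [Fin.strictMono_iff_lt_succ]
    intro i
    fin_cases i
    · exact h1
    · exact h2
  · fin_cases a <;> fin_cases b <;> simp [perm312, hm, hσ, hlt, hlt.le]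

theorem card_I2_add_card_I3 (hm : π m = 0) (hσ : ∀ j, π (m.succAbove j) = (σ j).succ)
    (h : Separated m.1 σ) :
    (I2 π).card + (I3 π).card = (m - 1) * invBelow m σ + m * (invBelow n σ - invBelow m σ) +
      ((I2 σ).card + (I3 σ).card) := by
  have hmn : m.1 ≤ n := Nat.lt_succ_iff.1 m.2
  have e : invBelow n σ = invBelow m σ +
      ∑ a, ∑ b, if IsInversion σ a b ∧ ¬ b.1 < m.1 then 1 else 0 := by
    simp only [invBelow, ← Finset.sum_add_distrib]
    refine Finset.sum_congr rfl fun a _ => Finset.sum_congr rfl fun b _ => ?_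
    have := b.2
    grind
  rw [e, Nat.add_sub_cancel_left, card_I2_delete hm hσ, card_I3_delete hm hσ]
  suffices hs : (∑ a, ∑ b, if IsInversion σ a b then
      ∑ i : Fin n, (if i.1 < m.1 ∧ i ≠ a ∧ i ≠ b then 1 else 0) else 0) + invBelow m σ =
      (m - 1) * invBelow m σ + m * ∑ a, ∑ b, if IsInversion σ a b ∧ ¬ b.1 < m.1 then 1 else 0 by
    omega
  simp only [invBelow, Finset.mul_sum, ← Finset.sum_add_distrib]
  refine Finset.sum_congr rfl fun a _ => Finset.sum_congr rfl fun b _ => ?_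
  by_cases hab : IsInversion σ a b
  · have h1 : b.1 < m.1 ∨ m.1 ≤ a.1 := by
      by_contra! h1
      exact (h a b h1.2 h1.1).not_gt hab.2
    have h2 := sum_lt_ne hmn hab.1 h1
    simp only [eq_true hab, true_and, if_true]
    rw [h2]
    split_ifs <;> simp
  · simp only [eq_false hab, false_and, if_false, add_zero, mul_zero]

end Delete

/-- The middle claim is needed for all `k` because deleting the minimum lowers `k` by one. The last
claim uses it at `k = m` and at `k = n`. -/
theorem exists_isCode (n : ℕ) (π : Equiv.Perm (Fin n)) : ∃ c, IsCode π c ∧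
    (∀ k ≤ n, Separated k π → Splits k c ∧ invBelow k π = (c.take k).sum) ∧
    (Avoids π perm312 → Good c ∧ (I2 π).card + (I3 π).card = codeDiam c) := by
  induction n with
  | zero =>
    refine ⟨[], ⟨rfl, trivial, ?_⟩, fun k hk _ => ?_, fun _ => ⟨trivial, ?_⟩⟩
    · ext x
      simp [permFun, codeFun]
    · obtain rfl : k = 0 := by omega
      simp [Splits, invBelow]
    · simp [card_I2_eq, card_I3_eq, codeDiam]
  | succ n ih =>
    obtain ⟨m, σ, hm, hσ⟩ := exists_delete_min π
    obtain ⟨c, h1, h2, h3⟩ := ih σ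
    have hmn : m.1 ≤ n := Nat.lt_succ_iff.1 m.2
    refine ⟨m :: c, ⟨by simp [h1.length_eq], ⟨by rw [h1.length_eq]; exact hmn, h1.bounded⟩, ?_⟩,
      fun k hk hs => ?_, fun ha => ?_⟩
    · rw [permFun_eq_insertMin hm hσ, h1.permFun_eq, codeFun]
    · cases k with
      | zero => simp [Splits, invBelow]
      | succ k =>
        obtain ⟨h4, h5⟩ := hs.delete hm hσ
        obtain ⟨h6, h7⟩ := h2 k (by omega) h5
        refine ⟨⟨h4, h6⟩, ?_⟩
        rw [invBelow_succ hm hσ h4, h7, List.take_succ_cons, List.sum_cons]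
    · obtain ⟨h4, h5⟩ := h3 (ha.delete hσ)
      have h6 := ha.separated hm hσ
      obtain ⟨h7, h8⟩ := h2 m hmn h6
      have h9 : invBelow n σ = (c.take m).sum + (c.drop m).sum := by
        -- Separation at `n` is vacuous, so this counts all inversions of `σ`.
        rw [(h2 n le_rfl fun x y _ hy => absurd y.2 (by omega)).2,
          List.take_of_length_le h1.length_eq.le, ← List.sum_append, List.take_append_drop]
      refine ⟨⟨h7, h4⟩, ?_⟩
      rw [card_I2_add_card_I3 hm hσ h6, h5, h8, h9, Nat.add_sub_cancel_left, codeDiam]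

/-! ### The braid arrangement -/

section Arrangement

variable {n : ℕ}

theorem mem_hyper {i j : Fin n} {x : Fin n → ℝ} : x ∈ hyper i j ↔ x i = x j := Iff.rfl

theorem hyper_comm (i j : Fin n) : hyper i j = hyper j i :=
  Submodule.ext fun _ => eq_comm

theorem hyper_mem_arrangement {i j : Fin n} (h : i ≠ j) : hyper i j ∈ arrangement n := by
  rcases lt_or_gt_of_ne h with h | h
  · exact ⟨i, j, h, rfl⟩
  · exact ⟨j, i, h, hyper_comm i j⟩

theorem exists_hyper_apply (π : Equiv.Perm (Fin n)) {H : Submodule ℝ (Fin n → ℝ)}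
    (hH : H ∈ arrangement n) : ∃ i j : Fin n, i < j ∧ H = hyper (π i) (π j) := by
  obtain ⟨a, b, hab, rfl⟩ := hH
  rcases lt_or_gt_of_ne (π.symm.injective.ne hab.ne) with h | h
  · exact ⟨_, _, h, by simp⟩
  · exact ⟨_, _, h, by simp [hyper_comm]⟩

theorem separates_hyper_iff {π : Equiv.Perm (Fin n)} {a b : Fin n} (hab : a < b) :
    Separates (hyper a b) (baseChamber n) (permChamber π) ↔ π.symm b < π.symm a := by
  constructor
  · rintro ⟨f, hf, hpos, hneg⟩
    by_contra! h
    have h' : π.symm a < π.symm b := lt_of_le_of_ne h (π.symm.injective.ne hab.ne)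
    have h1 : (0 : ℝ) < b.1 - a.1 := by
      rw [sub_pos]
      exact_mod_cast hab
    have h2 : (0 : ℝ) < (π.symm b).1 - (π.symm a).1 := by
      rw [sub_pos]
      exact_mod_cast h'
    -- The scale makes the difference of a point of each chamber lie in the hyperplane; `f` would
    -- then agree at both points, against its signs.
    set s : ℝ := ((b.1 : ℝ) - a.1) / ((π.symm b).1 - (π.symm a).1) with hs
    have hs0 : 0 < s := div_pos h1 h2
    have hx := hpos (fun t => (t.1 : ℝ)) (fun i j hij => by
      simpa using hij)
    have hy := hneg (fun t => s * ((π.symm t).1 : ℝ)) ⟨fun t => s * (t.1 : ℝ), fun i j hij => by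
      have : (i.1 : ℝ) < j.1 := by exact_mod_cast hij
      exact mul_lt_mul_of_pos_left this hs0, rfl⟩
    have hk : (fun t : Fin n => (t.1 : ℝ)) - (fun t => s * ((π.symm t).1 : ℝ)) ∈
        LinearMap.ker f := by
      rw [hf, mem_hyper]
      have : s * ((π.symm b).1 - (π.symm a).1) = b.1 - a.1 := div_mul_cancel₀ _ h2.ne'
      simp only [Pi.sub_apply]
      linarith
    rw [LinearMap.mem_ker, map_sub] at hk
    linarith
  · intro h
    refine ⟨LinearMap.proj (R := ℝ) (φ := fun _ : Fin n => ℝ) b -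
      LinearMap.proj (R := ℝ) (φ := fun _ : Fin n => ℝ) a, ?_, fun x hx => ?_, ?_⟩
    · ext x
      simp [mem_hyper, sub_eq_zero, eq_comm]
    · simpa using hx hab
    · rintro _ ⟨x, hx, rfl⟩
      simpa using hx h

theorem hyper_mem_L1_iff {π : Equiv.Perm (Fin n)} {i j : Fin n} (hij : i < j) :
    hyper (π i) (π j) ∈ L1 π ↔ π j < π i := by
  have hne : π i ≠ π j := π.injective.ne hij.ne
  rw [L1, Set.mem_ofPred_eq, and_iff_right (hyper_mem_arrangement hne)]
  rcases lt_or_gt_of_ne hne with h | h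
  · rw [separates_hyper_iff h]
    simp [hij.not_gt, h.not_gt]
  · rw [hyper_comm, separates_hyper_iff h]
    simp [hij, h]

/-! ### Rank-two flats -/

theorem inf_hyper_le_iff {a b c d p q : Fin n} (h1 : a ≠ c) (h2 : a ≠ d) (h3 : b ≠ c)
    (h4 : b ≠ d) : hyper a b ⊓ hyper c d ≤ hyper p q ↔
      p = q ∨ ((p = a ∨ p = b) ∧ (q = a ∨ q = b)) ∨ ((p = c ∨ p = d) ∧ (q = c ∨ q = d)) := by
  constructor
  · intro h
    -- A generic point of the flat: its only equal coordinates are those within one block.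
    have := @h (fun t => ((if t = a ∨ t = b then 0 else if t = c ∨ t = d then 1
      else t.1 + 2 : ℕ) : ℝ)) (by
        rw [Submodule.mem_inf, mem_hyper, mem_hyper]
        simp [h1.symm, h2.symm, h3.symm, h4.symm])
    rw [mem_hyper, Nat.cast_inj] at this
    grind
  · intro h x hx
    rw [Submodule.mem_inf, mem_hyper, mem_hyper] at hx
    rw [mem_hyper]
    grind

theorem inf_hyper_le_iff' {a b c p q : Fin n} : hyper a b ⊓ hyper b c ≤ hyper p q ↔
      p = q ∨ ((p = a ∨ p = b ∨ p = c) ∧ (q = a ∨ q = b ∨ q = c)) := by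
  constructor
  · intro h
    have := @h (fun t => ((if t = a ∨ t = b ∨ t = c then 0 else t.1 + 1 : ℕ) : ℝ)) (by
        rw [Submodule.mem_inf, mem_hyper, mem_hyper]
        simp)
    rw [mem_hyper, Nat.cast_inj] at this
    grind
  · intro h x hx
    rw [Submodule.mem_inf, mem_hyper, mem_hyper] at hx
    rw [mem_hyper]
    grind

theorem hyper_eq_iff {a b p q : Fin n} (h : p ≠ q) (he : hyper a b = hyper p q) :
    (p = a ∧ q = b) ∨ (p = b ∧ q = a) := by
  -- `hyper b b` is the whole space, so the three-index criterion also covers a single hyperplane.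
  have h1 : hyper a b ⊓ hyper b b ≤ hyper p q := he ▸ inf_le_left
  rw [inf_hyper_le_iff'] at h1
  grind

/-- The intersection of the hyperplanes of a pair of inversions with disjoint index sets. -/
def pairFlat (π : Equiv.Perm (Fin n)) (p : (Fin n × Fin n) × (Fin n × Fin n)) :
    Submodule ℝ (Fin n → ℝ) :=
  hyper (π p.1.1) (π p.1.2) ⊓ hyper (π p.2.1) (π p.2.2)

/-- The intersection of the three hyperplanes of an occurrence of `321`. -/
def tripleFlat (π : Equiv.Perm (Fin n)) (t : Fin n × Fin n × Fin n) :
    Submodule ℝ (Fin n → ℝ) :=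
  hyper (π t.1) (π t.2.1) ⊓ hyper (π t.2.1) (π t.2.2)

theorem mem_I2 {π : Equiv.Perm (Fin n)} {i j k l : Fin n} : ((i, j), (k, l)) ∈ I2 π ↔
    IsInversion π i j ∧ IsInversion π k l ∧ (i ≠ k ∧ i ≠ l ∧ j ≠ k ∧ j ≠ l) ∧ i < k := by
  simp only [I2, Finset.mem_filter_univ, Finset.disjoint_insert_left,
    Finset.disjoint_singleton_left, Finset.mem_insert, Finset.mem_singleton, not_or, ne_eq,
    and_assoc]

theorem mem_I3 {π : Equiv.Perm (Fin n)} {i j k : Fin n} : (i, j, k) ∈ I3 π ↔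
    IsInversion π i j ∧ IsInversion π i k ∧ IsInversion π j k := by
  simp only [I3, Finset.mem_filter_univ]

theorem pairFlat_le_iff {π : Equiv.Perm (Fin n)} {i j k l a b : Fin n}
    (h : ((i, j), (k, l)) ∈ I2 π) : pairFlat π ((i, j), (k, l)) ≤ hyper (π a) (π b) ↔
      a = b ∨ ((a = i ∨ a = j) ∧ (b = i ∨ b = j)) ∨ ((a = k ∨ a = l) ∧ (b = k ∨ b = l)) := by
  obtain ⟨_, _, ⟨h1, h2, h3, h4⟩, _⟩ := mem_I2.1 h
  rw [pairFlat, inf_hyper_le_iff (π.injective.ne h1) (π.injective.ne h2) (π.injective.ne h3)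
    (π.injective.ne h4)]
  simp only [EmbeddingLike.apply_eq_iff_eq]

theorem tripleFlat_le_iff {π : Equiv.Perm (Fin n)} {i j k a b : Fin n} :
    tripleFlat π (i, j, k) ≤ hyper (π a) (π b) ↔
      a = b ∨ ((a = i ∨ a = j ∨ a = k) ∧ (b = i ∨ b = j ∨ b = k)) := by
  rw [tripleFlat, inf_hyper_le_iff']
  simp only [EmbeddingLike.apply_eq_iff_eq]

theorem pairFlat_mem_L2 {π : Equiv.Perm (Fin n)} {p : (Fin n × Fin n) × (Fin n × Fin n)}
    (hp : p ∈ I2 π) : pairFlat π p ∈ L2 π := by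
  obtain ⟨⟨i, j⟩, k, l⟩ := p
  obtain ⟨h1, h2, h3, h4⟩ := mem_I2.1 hp
  have hkl : π k ≠ π l := π.injective.ne h2.1.ne
  refine ⟨⟨_, hyper_mem_arrangement (π.injective.ne h1.1.ne), _, hyper_mem_arrangement hkl,
    fun h => ?_, rfl⟩, fun H hH hle => ?_⟩
  · have := hyper_eq_iff hkl h
    simp only [EmbeddingLike.apply_eq_iff_eq] at this
    grind
  · obtain ⟨a, b, hab, rfl⟩ := exists_hyper_apply π hH
    rw [hyper_mem_L1_iff hab]
    rw [pairFlat_le_iff hp] at hle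
    grind

theorem tripleFlat_mem_L2 {π : Equiv.Perm (Fin n)} {t : Fin n × Fin n × Fin n}
    (ht : t ∈ I3 π) : tripleFlat π t ∈ L2 π := by
  obtain ⟨i, j, k⟩ := t
  obtain ⟨h1, h2, h3⟩ := mem_I3.1 ht
  have hjk : π j ≠ π k := π.injective.ne h3.1.ne
  refine ⟨⟨_, hyper_mem_arrangement (π.injective.ne h1.1.ne), _, hyper_mem_arrangement hjk,
    fun h => ?_, rfl⟩, fun H hH hle => ?_⟩
  · have := hyper_eq_iff hjk h
    simp only [EmbeddingLike.apply_eq_iff_eq] at this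
    grind
  · obtain ⟨a, b, hab, rfl⟩ := exists_hyper_apply π hH
    rw [hyper_mem_L1_iff hab]
    rw [tripleFlat_le_iff] at hle
    grind

theorem tripleFlat_swap_left (π : Equiv.Perm (Fin n)) (i j k : Fin n) :
    tripleFlat π (i, j, k) = tripleFlat π (j, i, k) := by
  ext x
  simp only [tripleFlat, Submodule.mem_inf, mem_hyper]
  grind

theorem tripleFlat_swap_right (π : Equiv.Perm (Fin n)) (i j k : Fin n) :
    tripleFlat π (i, j, k) = tripleFlat π (i, k, j) := by
  ext x
  simp only [tripleFlat, Submodule.mem_inf, mem_hyper]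
  grind

theorem exists_tripleFlat {π : Equiv.Perm (Fin n)} {i j k : Fin n} (hij : i ≠ j) (hik : i ≠ k)
    (hjk : j ≠ k) (h : ∀ H ∈ arrangement n, tripleFlat π (i, j, k) ≤ H → H ∈ L1 π) :
    ∃ t ∈ I3 π, tripleFlat π t = tripleFlat π (i, j, k) := by
  have sorted : ∀ a b c : Fin n, a < b → b < c →
      tripleFlat π (a, b, c) = tripleFlat π (i, j, k) →
      ∃ t ∈ I3 π, tripleFlat π t = tripleFlat π (i, j, k) := by
    intro a b c hab hbc he
    rw [← he] at h
    have key : ∀ p q : Fin n, p < q → (p = a ∨ p = b ∨ p = c) → (q = a ∨ q = b ∨ q = c) →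
        IsInversion π p q := fun p q hpq hp hq =>
      ⟨hpq, (hyper_mem_L1_iff hpq).1 (h _ (hyper_mem_arrangement (π.injective.ne hpq.ne))
        (tripleFlat_le_iff.2 (.inr ⟨hp, hq⟩)))⟩
    exact ⟨(a, b, c), mem_I3.2 ⟨key _ _ hab (by simp) (by simp),
      key _ _ (hab.trans hbc) (by simp) (by simp), key _ _ hbc (by simp) (by simp)⟩, he⟩
  have hl := tripleFlat_swap_left π
  have hr := tripleFlat_swap_right π
  rcases lt_or_gt_of_ne hij with h1 | h1 <;> rcases lt_or_gt_of_ne hik with h2 | h2 <;>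
    rcases lt_or_gt_of_ne hjk with h3 | h3
  · exact sorted i j k h1 h3 rfl
  · exact sorted i k j h2 h3 (hr ..)
  · exact absurd (h1.trans h3) h2.not_gt
  · exact sorted k i j h2 h1 ((hl ..).trans (hr ..))
  · exact sorted j i k h1 h2 (hl ..)
  · exact absurd (h3.trans h1) h2.not_gt
  · exact sorted j k i h3 h2 ((hr ..).trans (hl ..))
  · exact sorted k j i h3 h1 ((hl ..).trans ((hr ..).trans (hl ..)))

/-- Two distinct hyperplanes share one index or none. A shared index gives a triple, whose third
hyperplane also contains the flat and so must separate; after sorting this is a 321. -/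
theorem L2_subset (π : Equiv.Perm (Fin n)) :
    L2 π ⊆ pairFlat π '' (I2 π) ∪ tripleFlat π '' (I3 π) := by
  rintro X ⟨⟨H, hH, K, hK, hne, rfl⟩, hX⟩
  obtain ⟨i, j, hij, rfl⟩ := exists_hyper_apply π hH
  obtain ⟨k, l, hkl, rfl⟩ := exists_hyper_apply π hK
  have h1 : IsInversion π i j := ⟨hij, (hyper_mem_L1_iff hij).1 (hX _ hH inf_le_left)⟩
  have h2 : IsInversion π k l := ⟨hkl, (hyper_mem_L1_iff hkl).1 (hX _ hK inf_le_right)⟩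
  have triple : ∀ a b c : Fin n, a ≠ b → a ≠ c → b ≠ c →
      hyper (π i) (π j) ⊓ hyper (π k) (π l) = tripleFlat π (a, b, c) →
      hyper (π i) (π j) ⊓ hyper (π k) (π l) ∈
        pairFlat π '' (I2 π) ∪ tripleFlat π '' (I3 π) := by
    intro a b c hab hac hbc he
    rw [he] at hX ⊢
    exact .inr (exists_tripleFlat hab hac hbc hX)
  by_cases hik : i = k
  · subst hik
    have hjl : j ≠ l := fun h => hne (by rw [h])
    exact triple j i l hij.ne' hjl hkl.ne (by rw [hyper_comm]; rfl)
  by_cases hjk : j = k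
  · subst hjk
    exact triple i j l hij.ne (hij.trans hkl).ne hkl.ne rfl
  by_cases hil : i = l
  · subst hil
    exact triple k i j hkl.ne (hkl.trans hij).ne hij.ne (inf_comm ..)
  by_cases hjl : j = l
  · subst hjl
    exact triple i j k hij.ne hik hkl.ne' (by rw [hyper_comm (π k)]; rfl)
  left
  rcases lt_or_gt_of_ne hik with h | h
  · exact ⟨((i, j), (k, l)), mem_I2.2 ⟨h1, h2, ⟨hik, hil, hjk, hjl⟩, h⟩, rfl⟩
  · exact ⟨((k, l), (i, j)), mem_I2.2 ⟨h2, h1, ⟨Ne.symm hik, Ne.symm hjk, Ne.symm hil,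
      Ne.symm hjl⟩, h⟩, inf_comm ..⟩

theorem pairFlat_injOn (π : Equiv.Perm (Fin n)) : Set.InjOn (pairFlat π) (I2 π) := by
  rintro ⟨⟨i, j⟩, k, l⟩ hp ⟨⟨i', j'⟩, k', l'⟩ hp' he
  have key : ∀ a b, _ ↔ _ := fun a b =>
    (pairFlat_le_iff (a := a) (b := b) hp).symm.trans (he ▸ pairFlat_le_iff hp')
  obtain ⟨h1, h2, h3, h4⟩ := mem_I2.1 hp
  obtain ⟨h1', h2', h3', h4'⟩ := mem_I2.1 hp'
  have k1 := key i j
  have k2 := key k l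
  grind

theorem tripleFlat_injOn (π : Equiv.Perm (Fin n)) : Set.InjOn (tripleFlat π) (I3 π) := by
  rintro ⟨i, j, k⟩ hp ⟨i', j', k'⟩ hp' he
  have key : ∀ a b, _ ↔ _ := fun a b =>
    (tripleFlat_le_iff (π := π) (a := a) (b := b)).symm.trans (he ▸ tripleFlat_le_iff)
  obtain ⟨h1, h2, h3⟩ := mem_I3.1 hp
  obtain ⟨h1', h2', h3'⟩ := mem_I3.1 hp'
  have k1 := key i j
  have k2 := key j k
  grind

theorem disjoint_flats (π : Equiv.Perm (Fin n)) :
    Disjoint (pairFlat π '' (I2 π)) (tripleFlat π '' (I3 π)) := by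
  rw [Set.disjoint_left]
  rintro _ ⟨⟨⟨i, j⟩, k, l⟩, hp, rfl⟩ ⟨⟨i', j', k'⟩, hp', he⟩
  have key : ∀ a b, _ ↔ _ := fun a b =>
    (pairFlat_le_iff (a := a) (b := b) hp).symm.trans (he ▸ tripleFlat_le_iff)
  obtain ⟨h1, h2, h3, h4⟩ := mem_I2.1 hp
  obtain ⟨h1', h2', h3'⟩ := mem_I3.1 hp'
  have k1 := key i j
  have k2 := key k l
  have k3 := key i k
  grind

theorem encard_L2 (π : Equiv.Perm (Fin n)) :
    (L2 π).encard = (((I2 π).card + (I3 π).card : ℕ) : ℕ∞) := by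
  have h : L2 π = pairFlat π '' (I2 π) ∪ tripleFlat π '' (I3 π) := by
    refine (L2_subset π).antisymm (Set.union_subset ?_ ?_)
    · rintro _ ⟨p, hp, rfl⟩
      exact pairFlat_mem_L2 hp
    · rintro _ ⟨t, ht, rfl⟩
      exact tripleFlat_mem_L2 ht
  rw [h, Set.encard_union_eq (disjoint_flats π), (pairFlat_injOn π).encard_image,
    (tripleFlat_injOn π).encard_image, Set.encard_coe_eq_coe_finsetCard,
    Set.encard_coe_eq_coe_finsetCard, Nat.cast_add]

end Arrangement

end RedWord

/-- Connectedness is contained in the use of the extended diameter: it equals a natural number,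
hence is finite, so no two reduced words are at infinite distance. -/
theorem theorem6p5 (n : ℕ) (π : Equiv.Perm (Fin n)) (hπ : RedWord.Avoids π RedWord.perm312) :
    (RedWord.G π).ediam = (RedWord.L2 π).encard ∧
      (RedWord.L2 π).encard = (((RedWord.I2 π).card + (RedWord.I3 π).card : ℕ) : ℕ∞) := by
  obtain ⟨c, hc, -, h⟩ := RedWord.exists_isCode n π
  obtain ⟨hgood, hcard⟩ := h hπ
  rw [RedWord.encard_L2, hcard, hc.ediam_eq hgood]
  exact ⟨rfl, rfl⟩
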